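/- Let $\mathcal T_h=\{T_1,\dots,T_{n}\}$ be a finite conforming tetrahedral grid in $\mathbb R^3$: the $T$'s are distinct nondegenerate closed tetrahedra, and any two of them meet exactly in the convex hull of their common vertices. Let $\Omega$ be the interior of $\bigcup_{T\in\mathcal T_h}T$. On each $T$ fix an arbitrary numbering $\mathbf p_0,\mathbf p_1,\mathbf p_2,\mathbf p_3$ of its vertices. Conforming functions. Let $\{l_a\}$ be the Lagrange nodal basis of the continuous piecewise $P_3$ functions on $\mathcal T_h$, indexed by the cubic Lagrange nodes $a$ of the grid (all vertices, two nodes on each edge, one on each face triangle), and let $\mathbf e_1,\mathbf e_2,\mathbf e_3$ be the standard basis of $\mathbb R^3$. Bubbles. Let $\hat{\mathbf b}=(\hat b_1,\hat b_2,\hat b_3)^T\in[P_4]^3$ be the following polynomial in $(x,y,z)$: $$\hat b_1=\tfrac{263}{12}x^4+38x^3y+\tfrac{265}{3}x^3z+29x^2y^2+96x^2yz+\tfrac{209}{2}x^2z^2-16xy^3+42xy^2z +42xyz^2+\tfrac{103}{3}xz^3+\tfrac{7}{6}y^4-y^2z^2-\tfrac{335}{12}z^4-\tfrac{253}{6}x^3-\tfrac{87}{2}x^2y-119x^2z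 +\tfrac{21}{2}xy^2-56xyz-65xz^2+\tfrac{112}{3}z^3+\tfrac{703}{28}x^2+\tfrac{7}{2}xy+\tfrac{251}{7}xz-\tfrac{41}{28}y^2 +\tfrac{2}{7}yz-\tfrac{169}{14}z^2-\tfrac{181}{42}x+\tfrac{13}{21}y+\tfrac{73}{840},$$ $$\hat b_2=-\tfrac{233}{3}x^3y+\tfrac{67}{9}x^3z-\tfrac{233}{2}x^2y^2-235x^2yz+\tfrac{163}{6}x^2z^2-\tfrac{203}{3}xy^3-225xy^2z-209xyz^2 +\tfrac{301}{9}xz^3-\tfrac{64}{3}y^3z-21y^2z^2-\tfrac{16}{3}yz^3+\tfrac{113}{18}x^3+\tfrac{1105}{8}x^2y+\tfrac{155}{24}x^2z+\tfrac{1025}{8}xy^2 +\tfrac{1077}{4}xyz-\tfrac{469}{24}xz^2+\tfrac{79}{8}y^3+\tfrac{417}{8}y^2z+\tfrac{289}{8}yz^2-\tfrac{199}{72}z^3-\tfrac{625}{56}x^2-\tfrac{505}{7}xy -\tfrac{94}{7}xz-\tfrac{447}{28}y^2-\tfrac{251}{7}yz+\tfrac{317}{56}x+\tfrac{625}{84}y+\tfrac{101}{42}z-\tfrac{383}{630},$$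 $$\hat b_3=-10x^3y-10x^3z+x^2y^2+119x^2yz-15x^2z^2+16xy^3+145xy^2z+129xyz^2 +16y^3z+11y^2z^2-\tfrac{29}{4}z^4-\tfrac{93}{8}x^2y-\tfrac{61}{8}x^2z-\tfrac{301}{8}xy^2-\tfrac{693}{4}xyz-\tfrac{141}{8}xz^2 -\tfrac{13}{4}y^3-\tfrac{321}{8}y^2z-\tfrac{193}{8}yz^2+\tfrac{77}{8}z^3+\tfrac{181}{56}x^2+\tfrac{363}{14}xy+\tfrac{307}{14}xz+\tfrac{389}{56}y^2 +\tfrac{199}{7}yz-\tfrac{563}{168}x-\tfrac{33}{8}y-\tfrac{263}{84}z+\tfrac{103}{210}.$$ For $T\in\mathcal T_h$ and $i=1,\dots,9$ let $\mathbf F_i$ be the affine map sending the points $\mathbf 0,\mathbf e_1,\mathbf e_2,\mathbf e_3$, in this order, to the vertices of $T$ in the order $$0123,\ 0231,\ 0312,\ 1203,\ 1032,\ 1320,\ 2013,\ 2301,\ 3021$$ (for $i=1,\dots,9$ respectively, $k$ standing for $\mathbf p_k$), let $J_i$ be its Jacobi matrix, and put $\mathbf b_{T,i}(\mathbf x)=J_i\,\hat{\mathbf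 b}(\mathbf F_i^{-1}(\mathbf x))$ on $T$ and $\mathbf b_{T,i}=\mathbf 0$ outside $T$. Space and form. For real coefficients $c=(c_{a,m})$ and $d=(d_{T,i})$ put $$\mathbf v_c=\sum_a\sum_{m=1}^3 c_{a,m}\,l_a\mathbf e_m,\qquad \mathbf v_b=\sum_{T\in\mathcal T_h}\sum_{i=1}^9 d_{T,i}\,\mathbf b_{T,i},$$ call $c$ admissible if $\mathbf v_c=\mathbf 0$ on $\partial\Omega$, and let $\mathbf V_h=\{\mathbf v_c+\mathbf v_b:\ c \text{ admissible}, d \text{ arbitrary}\}$. Let $$(\nabla\mathbf u_h,\nabla\mathbf v_h)=\sum_{T\in\mathcal T_h}\int_T\nabla\mathbf u_h:\nabla\mathbf v_h\,d\mathbf x .$$ Lemma. The form $(\nabla\mathbf u_h,\nabla\mathbf v_h)$ is positive definite on the coefficients of $\mathbf V_h$: if $c$ is admissible and $(c,d)\ne(0,0)$, then $\mathbf v_h=\mathbf v_c+\mathbf v_b$ satisfies $(\nabla\mathbf v_h,\nabla\mathbf v_h)>0$. Consequently every $\mathbf v_h\in\mathbf V_h$ has exactly one representation $\mathbf v_h=\mathbf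 v_c+\mathbf v_b$ with $c$ admissible (the bubbles are linearly independent of the conforming $P_3$ functions with zero boundary values), and $(\nabla\mathbf u_h,\nabla\mathbf v_h)$ is an inner product on $\mathbf V_h$, so that $(\nabla\mathbf v_h,\nabla\mathbf v_h)^{1/2}$ is a norm on $\mathbf V_h$. -/

import Mathlib

noncomputable section

namespace StokesP3

/-- Three-dimensional space in Cartesian coordinates (no norm is used, only the topology,
Lebesgue measure and partial derivatives). -/
abbrev R3 : Type := Fin 3 → ℝ

/-! ### The reference bubble on the unit tetrahedron -/

/-- Component 1 of the reference bubble. -/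
def bHat1 (x y z : ℝ) : ℝ :=
  263 / 12 * x ^ 4 + 38 * x ^ 3 * y + 265 / 3 * x ^ 3 * z + 29 * x ^ 2 * y ^ 2 +
  96 * x ^ 2 * y * z + 209 / 2 * x ^ 2 * z ^ 2 - 16 * x * y ^ 3 + 42 * x * y ^ 2 * z +
  42 * x * y * z ^ 2 + 103 / 3 * x * z ^ 3 + 7 / 6 * y ^ 4 - y ^ 2 * z ^ 2 - 335 / 12 * z ^ 4 -
  253 / 6 * x ^ 3 - 87 / 2 * x ^ 2 * y - 119 * x ^ 2 * z + 21 / 2 * x * y ^ 2 -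
  56 * x * y * z - 65 * x * z ^ 2 + 112 / 3 * z ^ 3 + 703 / 28 * x ^ 2 + 7 / 2 * x * y +
  251 / 7 * x * z - 41 / 28 * y ^ 2 + 2 / 7 * y * z - 169 / 14 * z ^ 2 - 181 / 42 * x +
  13 / 21 * y + 73 / 840

/-- Component 2 of the reference bubble. -/
def bHat2 (x y z : ℝ) : ℝ :=
  -233 / 3 * x ^ 3 * y + 67 / 9 * x ^ 3 * z - 233 / 2 * x ^ 2 * y ^ 2 - 235 * x ^ 2 * y * z +
  163 / 6 * x ^ 2 * z ^ 2 - 203 / 3 * x * y ^ 3 - 225 * x * y ^ 2 * z - 209 * x * y * z ^ 2 +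
  301 / 9 * x * z ^ 3 - 64 / 3 * y ^ 3 * z - 21 * y ^ 2 * z ^ 2 - 16 / 3 * y * z ^ 3 +
  113 / 18 * x ^ 3 + 1105 / 8 * x ^ 2 * y + 155 / 24 * x ^ 2 * z + 1025 / 8 * x * y ^ 2 +
  1077 / 4 * x * y * z - 469 / 24 * x * z ^ 2 + 79 / 8 * y ^ 3 + 417 / 8 * y ^ 2 * z +
  289 / 8 * y * z ^ 2 - 199 / 72 * z ^ 3 - 625 / 56 * x ^ 2 - 505 / 7 * x * y - 94 / 7 * x * z -
  447 / 28 * y ^ 2 - 251 / 7 * y * z + 317 / 56 * x + 625 / 84 * y + 101 / 42 * z -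
  383 / 630

/-- Component 3 of the reference bubble. -/
def bHat3 (x y z : ℝ) : ℝ :=
  -10 * x ^ 3 * y - 10 * x ^ 3 * z + x ^ 2 * y ^ 2 + 119 * x ^ 2 * y * z - 15 * x ^ 2 * z ^ 2 +
  16 * x * y ^ 3 + 145 * x * y ^ 2 * z + 129 * x * y * z ^ 2 + 16 * y ^ 3 * z +
  11 * y ^ 2 * z ^ 2 - 29 / 4 * z ^ 4 - 93 / 8 * x ^ 2 * y - 61 / 8 * x ^ 2 * z -
  301 / 8 * x * y ^ 2 - 693 / 4 * x * y * z - 141 / 8 * x * z ^ 2 - 13 / 4 * y ^ 3 -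
  321 / 8 * y ^ 2 * z - 193 / 8 * y * z ^ 2 + 77 / 8 * z ^ 3 + 181 / 56 * x ^ 2 +
  363 / 14 * x * y + 307 / 14 * x * z + 389 / 56 * y ^ 2 + 199 / 7 * y * z - 563 / 168 * x -
  33 / 8 * y - 263 / 84 * z + 103 / 210

/-- The reference `P₄` bubble on the unit reference tetrahedron. -/
def bHat (x : R3) : R3 :=
  ![bHat1 (x 0) (x 1) (x 2), bHat2 (x 0) (x 1) (x 2), bHat3 (x 0) (x 1) (x 2)]

/-! ### Affine maps from the reference tetrahedron -/

/-- Jacobi matrix of the affine map sending the reference vertices `0, e₁, e₂, e₃` to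
`p 0, p 1, p 2, p 3`. -/
def jac (p : Fin 4 → R3) : Matrix (Fin 3) (Fin 3) ℝ :=
  Matrix.of fun r j => p j.succ r - p 0 r

/-- The affine map sending the reference vertices `0, e₁, e₂, e₃` to `p 0, p 1, p 2, p 3`. -/
def refMap (p : Fin 4 → R3) (x : R3) : R3 := p 0 + (jac p).mulVec x

/-- The inverse of `refMap p` (for affinely independent `p`). -/
def refMapInv (p : Fin 4 → R3) (x : R3) : R3 := (jac p)⁻¹.mulVec (x - p 0)

theorem jac_det_isUnit {p : Fin 4 → R3} (hp : AffineIndependent ℝ p) : IsUnit (jac p).det := by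
  rw [affineIndependent_iff_linearIndependent_vsub ℝ p 0] at hp
  have h : LinearIndependent ℝ (jac p).col := by
    have := hp.comp (fun j : Fin 3 => (⟨j.succ, Fin.succ_ne_zero j⟩ : {i : Fin 4 // i ≠ 0}))
      (fun a b h => Fin.succ_injective _ (congrArg Subtype.val h))
    exact this
  rw [Matrix.linearIndependent_cols_iff_isUnit] at h
  exact (Matrix.isUnit_iff_isUnit_det _).1 h

theorem refMap_refMapInv {p : Fin 4 → R3} (hp : AffineIndependent ℝ p) (x : R3) :
    refMap p (refMapInv p x) = x := by
  simp [refMap, refMapInv, Matrix.mulVec_mulVec, Matrix.mul_nonsing_inv _ (jac_det_isUnit hp)]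

theorem refMapInv_refMap {p : Fin 4 → R3} (hp : AffineIndependent ℝ p) (x : R3) :
    refMapInv p (refMap p x) = x := by
  simp [refMap, refMapInv, Matrix.mulVec_mulVec, Matrix.nonsing_inv_mul _ (jac_det_isUnit hp)]

/-- The barycentric coordinates of `x` with respect to the tetrahedron with vertices `p`. -/
def bary (p : Fin 4 → R3) (i : Fin 4) (x : R3) : ℝ :=
  (Fin.cons (1 - ∑ j, refMapInv p x j) (refMapInv p x) : Fin 4 → ℝ) i

/-- The nine numberings of the vertices of one tetrahedron: with the vertices named
`1, 6, 7, 2` in positions `0, 1, 2, 3`, these are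
`1672, 1726, 1267, 6712, 6127, 6271, 7162, 7216, 2176`. -/
def numbering : Fin 9 → Fin 4 → Fin 4 :=
  ![![0, 1, 2, 3], ![0, 2, 3, 1], ![0, 3, 1, 2],
    ![1, 2, 0, 3], ![1, 0, 3, 2], ![1, 3, 2, 0],
    ![2, 0, 1, 3], ![2, 3, 0, 1], ![3, 0, 2, 1]]

/-- The Piola image `J b̂(F⁻¹ x)` of the reference bubble on the tetrahedron with vertices `p`. -/
def piolaBubble (p : Fin 4 → R3) (x : R3) : R3 := (jac p).mulVec (bHat (refMapInv p x))

/-! ### Local cubic Lagrange basis -/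

/-- The twenty multi-indices `k = (k₀, k₁, k₂, k₃)` with `k₀ + k₁ + k₂ + k₃ = 3`. -/
def multiIdx : Finset (Fin 4 → ℕ) := Finset.Nat.antidiagonalTuple 4 3

/-- The cubic Lagrange node with barycentric coordinates `k / 3`. -/
def localNode (p : Fin 4 → R3) (k : Fin 4 → ℕ) : R3 := ∑ i, ((k i : ℝ) / 3) • p i

/-- The cubic Lagrange polynomial on the tetrahedron `p` that is `1` at the node `k` and `0` at
the other nineteen nodes. -/
def localNodal (p : Fin 4 → R3) (k : Fin 4 → ℕ) (x : R3) : ℝ :=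
  ∏ i, ∏ m ∈ Finset.range (k i), (3 * bary p i x - m) / (m + 1)

/-! ### Tetrahedral grids and the finite element space -/

/-- A (conforming) tetrahedral grid of `n` distinct nondegenerate closed tetrahedra, each with a
numbering of its vertices. Any two tetrahedra meet exactly in the convex hull of their common
vertices, i.e. in the empty set, a common vertex, a common edge or a common face. -/
structure TetMesh (n : ℕ) where
  /-- the vertices of each tetrahedron -/
  vert : Fin n → Fin 4 → R3
  affineIndependent : ∀ t, AffineIndependent ℝ (vert t)
  distinct : Function.Injective fun t => Set.range (vert t)
  conforming : ∀ s t, convexHull ℝ (Set.range (vert s)) ∩ convexHull ℝ (Set.range (vert t)) =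
    convexHull ℝ (Set.range (vert s) ∩ Set.range (vert t))

namespace TetMesh

variable {n : ℕ} (M : TetMesh n)

/-- The closed tetrahedron number `t`. -/
def tet (t : Fin n) : Set R3 := convexHull ℝ (Set.range (M.vert t))

/-- The open polyhedral domain that is covered by the grid. -/
def domain : Set R3 := interior (⋃ t, M.tet t)

/-- The cubic Lagrange nodes of the grid: the vertices, two nodes on each edge and one on each
face triangle. -/
def nodes : Finset R3 := Finset.univ.biUnion fun t => multiIdx.image (localNode (M.vert t))

open Classical in
/-- The Lagrange nodal basis function of the node `a`: the continuous function on the closed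
domain, cubic on each tetrahedron, that is `1` at `a` and `0` at all other nodes. It is computed
in some tetrahedron containing `x`; by conformity the value does not depend on which.
It is extended by zero outside the closed domain. -/
def nodal (a : R3) (x : R3) : ℝ :=
  if h : ∃ t, x ∈ M.tet t then
    ∑ k ∈ multiIdx with localNode (M.vert h.choose) k = a, localNodal (M.vert h.choose) k x
  else 0

/-- The `i`-th bubble on the tetrahedron `t`, zero outside that tetrahedron. -/
def bubble (t : Fin n) (i : Fin 9) : R3 → R3 :=
  (M.tet t).indicator (piolaBubble (M.vert t ∘ numbering i))

/-- The conforming part `∑ c_{a,m} l_a e_m` over all nodes `a` and `m = 1, 2, 3`. -/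
def conformingPart (c : M.nodes → Fin 3 → ℝ) : R3 → R3 :=
  ∑ a : M.nodes, ∑ m : Fin 3, c a m • fun x => M.nodal a x • (Pi.single m 1 : R3)

/-- The bubble part `∑_T ∑_{i=1}^9 d_{T,i} b_{T,i}`. -/
def bubblePart (d : Fin n → Fin 9 → ℝ) : R3 → R3 :=
  ∑ t : Fin n, ∑ i : Fin 9, d t i • M.bubble t i

/-- The coefficients `c` of the conforming part are admissible if that part vanishes on the
boundary of the domain. -/
def Admissible (c : M.nodes → Fin 3 → ℝ) : Prop :=
  ∀ x ∈ frontier M.domain, M.conformingPart c x = 0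

/-- The nonconforming velocity space. -/
def Vh : Submodule ℝ (R3 → R3) where
  carrier := {v | ∃ (c : M.nodes → Fin 3 → ℝ) (d : Fin n → Fin 9 → ℝ),
    M.Admissible c ∧ v = M.conformingPart c + M.bubblePart d}
  zero_mem' := ⟨0, 0, fun x _ => by simp [conformingPart], by simp [conformingPart, bubblePart]⟩
  add_mem' := by
    rintro _ _ ⟨c, d, hc, rfl⟩ ⟨c', d', hc', rfl⟩
    have h : M.conformingPart (c + c') = M.conformingPart c + M.conformingPart c' := by
      simp only [conformingPart, Pi.add_apply, add_smul, Finset.sum_add_distrib]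
    have h' : M.bubblePart (d + d') = M.bubblePart d + M.bubblePart d' := by
      simp only [bubblePart, Pi.add_apply, add_smul, Finset.sum_add_distrib]
    refine ⟨c + c', d + d', fun x hx => ?_, ?_⟩
    · rw [h, Pi.add_apply, hc x hx, hc' x hx, add_zero]
    · rw [h, h', add_add_add_comm]
  smul_mem' := by
    rintro r _ ⟨c, d, hc, rfl⟩
    have h : M.conformingPart (r • c) = r • M.conformingPart c := by
      simp only [conformingPart, Pi.smul_apply, smul_assoc, Finset.smul_sum]
    have h' : M.bubblePart (r • d) = r • M.bubblePart d := by
      simp only [bubblePart, Pi.smul_apply, smul_assoc, Finset.smul_sum]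
    refine ⟨r • c, r • d, fun x hx => ?_, ?_⟩
    · rw [h, Pi.smul_apply, hc x hx, smul_zero]
    · rw [h, h', smul_add]

/-- The form `(∇u, ∇v) = ∑_T ∫_T ∇u : ∇v`, with the gradient taken tetrahedron by tetrahedron. -/
def gradForm (u v : R3 → R3) : ℝ :=
  ∑ t : Fin n, ∫ x in interior (M.tet t), ∑ m : Fin 3, ∑ r : Fin 3,
    fderiv ℝ u x (Pi.single r 1) m * fderiv ℝ v x (Pi.single r 1) m

end TetMesh

end StokesP3

end

/-!
A function of zero energy is constant on each tetrahedron. Fourth differences annihilate cubic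
polynomials, so on each tetrahedron they see only the quartic part of the bubble component. Taken
along the three edges through one vertex, they turn this constancy into a nonsingular `9 × 9`
linear system for the bubble coefficients, which therefore vanish. What remains is a continuous
function that is constant on each tetrahedron and vanishes on `∂Ω`: a nonzero value would be taken
on a nonempty compact set that is also open. So all nodal values vanish.
-/

noncomputable section

namespace StokesP3

open Filter Topology Finset

section ForwardDifference

theorem fwdDiff_iter_map_comp {M N G H : Type*} [AddCommMonoid M] [AddCommMonoid N]
    [AddCommGroup G] [AddCommGroup H] {g : M → N} {w : M} {v : N}
    (hg : ∀ x, g (x + w) = g x + v) (φ : G →+ H) (f : N → G) (n : ℕ) :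
    (fwdDiff w)^[n] (fun x => φ (f (g x))) = fun x => φ ((fwdDiff v)^[n] f (g x)) := by
  have hsemi : Function.Semiconj (fun (f : N → G) x => φ (f (g x))) (fwdDiff v) (fwdDiff w) :=
      fun f => by
    ext x
    simp only [fwdDiff, hg, map_sub]
  exact (hsemi.iterate_right n f).symm

theorem fwdDiff_iter_four {M G : Type*} [AddCommMonoid M] [AddCommGroup G] (f : M → G) (w y : M) :
    (fwdDiff w)^[4] f y =
      f y - 4 • f (y + w) + 6 • f (y + 2 • w) - 4 • f (y + 3 • w) + f (y + 4 • w) := by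
  simp only [fwdDiff_iter_eq_sum_shift, Finset.sum_range_succ, Finset.sum_range_zero, Nat.choose]
  simp only [Int.reduceNeg, tsub_zero, Int.reducePow, Nat.cast_one, mul_one, zero_nsmul, add_zero,
    one_smul, zero_add, Nat.add_one_sub_one, Nat.reduceAdd, Nat.cast_ofNat, neg_mul, one_mul,
    neg_smul, Nat.reduceSub, even_two, Even.neg_pow, one_pow, pow_one, tsub_self, pow_zero]
  abel

theorem fwdDiff_iter_prod_affineMap {R E ι : Type*} [CommRing R] [AddCommGroup E] [Module R E]
    (s : Finset ι) (A : ι → E →ᵃ[R] R) {n : ℕ} (hn : #s < n) (w : E) :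
    (fwdDiff w)^[n] (fun x => ∏ i ∈ s, A i x) = 0 := by
  funext y
  let P : Polynomial R :=
    ∏ i ∈ s, (Polynomial.C ((A i).linear w) * Polynomial.X + Polynomial.C (A i y))
  have hdeg : P.natDegree < n := calc
    P.natDegree ≤ ∑ i ∈ s, 1 := (Polynomial.natDegree_prod_le _ _).trans
      (Finset.sum_le_sum fun _ _ => Polynomial.natDegree_linear_le)
    _ < n := by simpa using hn
  have hline : ∀ t : R, P.eval t = ∏ i ∈ s, A i (y + t • w) := fun t => by
    rw [Polynomial.eval_prod]
    refine Finset.prod_congr rfl fun i _ => ?_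
    rw [add_comm y, ← vadd_eq_add (t • w), AffineMap.map_vadd, map_smul]
    simp only [Polynomial.eval_add, Polynomial.eval_mul, Polynomial.eval_C, Polynomial.eval_X,
      vadd_eq_add, smul_eq_mul, mul_comm t]
  have h := fwdDiff_iter_map_comp (g := fun t : R => y + t • w) (w := 1) (v := w)
    (fun t => by module) (AddMonoidHom.id R) (fun x => ∏ i ∈ s, A i x) n
  simp only [AddMonoidHom.id_apply, ← hline] at h
  rw [Polynomial.fwdDiff_iter_eq_zero_of_degree_lt hdeg] at h
  simpa using (congrFun h 0).symm

theorem eventually_fwdDiff_iter_eq_zero {M G : Type*} [AddCommMonoid M] [TopologicalSpace M]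
    [ContinuousAdd M] [AddCommGroup G] {f : M → G} {x : M} {a : G} (hf : ∀ᶠ y in 𝓝 x, f y = a)
    {n : ℕ} (hn : n ≠ 0) : ∀ᶠ w in 𝓝 0, (fwdDiff w)^[n] f x = 0 := by
  have hshift : ∀ k : ℕ, ∀ᶠ w in 𝓝 (0 : M), f (x + k • w) = a := fun k => by
    have hcont : Continuous fun w : M => x + k • w := by fun_prop
    exact (hcont.tendsto' 0 x (by simp)).eventually hf
  filter_upwards [(Finset.range (n + 1)).eventually_all.2 fun k _ => hshift k] with w hw
  obtain ⟨m, rfl⟩ := Nat.exists_eq_succ_of_ne_zero hn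
  have hconst : (fwdDiff w)^[m + 1] (fun _ : M => a) x = 0 := by
    rw [Function.iterate_succ_apply, fwdDiff_const]
    exact congrFun (Function.iterate_fixed (fwdDiff_const w 0) m) x
  rw [← hconst, fwdDiff_iter_eq_sum_shift, fwdDiff_iter_eq_sum_shift]
  exact Finset.sum_congr rfl fun k hk => by rw [hw k hk]

end ForwardDifference

section HasC1Extension

variable {E F : Type*} [NormedAddCommGroup E] [NormedSpace ℝ E] [NormedAddCommGroup F]
  [NormedSpace ℝ F] {U : Set E} {u : E → F}

/-- `u` agrees on `U` with a function that is `C¹` on the whole space, so that on a bounded open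
set `U` its gradient is bounded. -/
def HasC1Extension (u : E → F) (U : Set E) : Prop :=
  ∃ g, ContDiff ℝ 1 g ∧ Set.EqOn u g U

theorem HasC1Extension.differentiableAt (hU : IsOpen U) (hu : HasC1Extension u U) {x : E}
    (hx : x ∈ U) : DifferentiableAt ℝ u x := by
  obtain ⟨g, hg, hug⟩ := hu
  exact (hg.differentiable one_ne_zero x).congr_of_eventuallyEq
    (hug.eventuallyEq_of_mem (hU.mem_nhds hx))

end HasC1Extension

section Gradient

open MeasureTheory

variable {ι κ : Type*} [Fintype ι] [DecidableEq ι] [Fintype κ]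
  {U : Set (ι → ℝ)} {u v w : (ι → ℝ) → κ → ℝ} {x : ι → ℝ}

/-- The Frobenius product `∇u : ∇v` at a point. -/
def gradDot (u v : (ι → ℝ) → κ → ℝ) (x : ι → ℝ) : ℝ :=
  ∑ m, ∑ r, fderiv ℝ u x (Pi.single r 1) m * fderiv ℝ v x (Pi.single r 1) m

theorem gradDot_comm (u v : (ι → ℝ) → κ → ℝ) (x : ι → ℝ) : gradDot u v x = gradDot v u x := by
  simp only [gradDot, mul_comm]

theorem gradDot_self_nonneg (u : (ι → ℝ) → κ → ℝ) (x : ι → ℝ) : 0 ≤ gradDot u u x :=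
  sum_nonneg fun _ _ => sum_nonneg fun _ _ => mul_self_nonneg _

theorem gradDot_self_eq_zero : gradDot u u x = 0 ↔ fderiv ℝ u x = 0 := by
  refine ⟨fun h => ?_, fun h => by simp [gradDot, h]⟩
  have hpartial : ∀ m r, fderiv ℝ u x (Pi.single r 1) m = 0 := by
    simpa [gradDot, sum_eq_zero_iff_of_nonneg, sum_nonneg, mul_self_nonneg] using h
  refine ContinuousLinearMap.coe_injective ((Pi.basisFun ℝ ι).ext fun r => funext fun m => ?_)
  simpa using hpartial m r

theorem continuous_gradDot (hu : ContDiff ℝ 1 u) (hv : ContDiff ℝ 1 v) :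
    Continuous (gradDot u v) := by
  have hpartial : ∀ {f : (ι → ℝ) → κ → ℝ}, ContDiff ℝ 1 f → ∀ m r,
      Continuous fun x => fderiv ℝ f x (Pi.single r 1) m := fun hf m _ =>
    (continuous_apply m).comp ((hf.continuous_fderiv one_ne_zero).clm_apply continuous_const)
  exact continuous_finsetSum _ fun m _ => continuous_finsetSum _ fun r _ =>
    (hpartial hu m r).mul (hpartial hv m r)

namespace HasC1Extension

theorem exists_continuous_eqOn_gradDot (hU : IsOpen U) (hu : HasC1Extension u U)
    (hv : HasC1Extension v U) : ∃ f, Continuous f ∧ Set.EqOn (gradDot u v) f U := by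
  obtain ⟨f, hf, huf⟩ := hu
  obtain ⟨g, hg, hvg⟩ := hv
  refine ⟨gradDot f g, continuous_gradDot hf hg, fun x hx => ?_⟩
  simp only [gradDot, (huf.eventuallyEq_of_mem (hU.mem_nhds hx)).fderiv_eq,
    (hvg.eventuallyEq_of_mem (hU.mem_nhds hx)).fderiv_eq]

theorem integrableOn_gradDot (hU : IsOpen U) (hb : Bornology.IsBounded U)
    (hu : HasC1Extension u U) (hv : HasC1Extension v U) : IntegrableOn (gradDot u v) U := by
  obtain ⟨f, hf, huvf⟩ := hu.exists_continuous_eqOn_gradDot hU hv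
  exact ((hf.continuousOn.integrableOn_compact hb.isCompact_closure).mono_set
    subset_closure).congr_fun huvf.symm hU.measurableSet

theorem setIntegral_gradDot_add_left (hU : IsOpen U) (hb : Bornology.IsBounded U)
    (hu : HasC1Extension u U) (hv : HasC1Extension v U) (hw : HasC1Extension w U) :
    ∫ x in U, gradDot (u + v) w x = (∫ x in U, gradDot u w x) + ∫ x in U, gradDot v w x := by
  rw [← integral_add (hu.integrableOn_gradDot hU hb hw) (hv.integrableOn_gradDot hU hb hw)]
  refine setIntegral_congr_fun hU.measurableSet fun x hx => ?_
  simp only [gradDot, fderiv_add (hu.differentiableAt hU hx) (hv.differentiableAt hU hx),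
    add_apply, Pi.add_apply, add_mul, sum_add_distrib]

theorem setIntegral_gradDot_smul_left (hU : IsOpen U) (hu : HasC1Extension u U) (r : ℝ)
    (w : (ι → ℝ) → κ → ℝ) :
    ∫ x in U, gradDot (r • u) w x = r * ∫ x in U, gradDot u w x := by
  rw [← integral_const_mul]
  refine setIntegral_congr_fun hU.measurableSet fun x hx => ?_
  simp only [gradDot, fderiv_const_smul (hu.differentiableAt hU hx), smul_apply, Pi.smul_apply,
    smul_eq_mul, mul_assoc, mul_sum]

theorem exists_eq_const_of_setIntegral_gradDot_self (hU : IsOpen U) (hc : IsPreconnected U)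
    (hb : Bornology.IsBounded U) (hu : HasC1Extension u U)
    (h : ∫ x in U, gradDot u u x = 0) : ∃ a, ∀ x ∈ U, u x = a := by
  rw [integral_eq_zero_iff_of_nonneg (gradDot_self_nonneg u)
    (hu.integrableOn_gradDot hU hb hu)] at h
  obtain ⟨f, hf, huf⟩ := hu.exists_continuous_eqOn_gradDot hU hu
  have hzero : Set.EqOn (gradDot u u) 0 U :=
    Measure.eqOn_open_of_ae_eq h hU (hf.continuousOn.congr huf) continuousOn_const
  exact hU.exists_is_const_of_fderiv_eq_zero hc
    (fun x hx => (hu.differentiableAt hU hx).differentiableWithinAt)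
    fun x hx => gradDot_self_eq_zero.1 (hzero hx)

end HasC1Extension

end Gradient

section Topology

/-- A nonzero value would be taken on a nonempty compact set, whose frontier is nonempty but can
meet neither the frontier nor the interior of the union of the cells. -/
theorem eq_zero_of_const_on_cells {X E ι : Type*} [TopologicalSpace X] [T2Space X]
    [PreconnectedSpace X] [NoncompactSpace X] [Zero E] [Finite ι] {K : ι → Set X} {u : X → E}
    (hK : ∀ i, IsCompact (K i)) (hreg : ∀ i, K i ⊆ closure (interior (K i)))
    (hconst : ∀ i, ∃ a, ∀ x ∈ K i, u x = a)
    (hbd : ∀ x ∈ frontier (interior (⋃ i, K i)), u x = 0) {i : ι} {x : X} (hx : x ∈ K i) :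
    u x = 0 := by
  choose a ha using hconst
  by_contra hne
  set S : Set X := ⋃ j ∈ {j | a j = u x}, K j
  set R : Set X := ⋃ j ∈ {j | a j ≠ u x}, K j
  have hS : IsCompact S := (Set.toFinite _).isCompact_biUnion fun j _ => hK j
  have hR : IsClosed R := (Set.toFinite _).isClosed_biUnion fun j _ => (hK j).isClosed
  have hUS : (⋃ j, K j) \ R ⊆ S := by
    rintro y ⟨hy, hyR⟩
    obtain ⟨j, hj⟩ := Set.mem_iUnion.1 hy
    exact Set.mem_biUnion (not_not.1 fun h => hyR (Set.mem_biUnion h hj)) hj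
  obtain ⟨y, hyS, hyint⟩ : (frontier S).Nonempty :=
    nonempty_frontier_iff.2 ⟨⟨x, Set.mem_biUnion (ha i x hx).symm hx⟩, hS.ne_univ⟩
  rw [hS.isClosed.closure_eq] at hyS
  obtain ⟨j, hj, hyj⟩ := Set.mem_iUnion₂.1 hyS
  have hy : u y = u x := (ha j y hyj).trans hj
  have hyU : y ∈ interior (⋃ j, K j) := by
    by_contra hyU
    refine hne (hy ▸ hbd y ⟨?_, by rwa [interior_interior]⟩)
    exact closure_mono (interior_mono (Set.subset_iUnion K j)) (hreg j hyj)
  have hyR : y ∉ R := fun h => by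
    obtain ⟨k, hk, hyk⟩ := Set.mem_iUnion₂.1 h
    exact hk ((ha k y hyk).symm.trans hy)
  exact hyint (interior_maximal
    ((Set.sdiff_subset_sdiff_left interior_subset).trans hUS) (isOpen_interior.sdiff hR)
    ⟨hyU, hyR⟩)

end Topology

section QuarticPart

/-- The homogeneous quartic part of the reference bubble `bHat`. -/
def bHatQuartic (x : R3) : R3 :=
  ![263 / 12 * x 0 ^ 4 + 38 * x 0 ^ 3 * x 1 + 265 / 3 * x 0 ^ 3 * x 2 + 29 * x 0 ^ 2 * x 1 ^ 2 +
      96 * x 0 ^ 2 * x 1 * x 2 + 209 / 2 * x 0 ^ 2 * x 2 ^ 2 - 16 * x 0 * x 1 ^ 3 +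
      42 * x 0 * x 1 ^ 2 * x 2 + 42 * x 0 * x 1 * x 2 ^ 2 + 103 / 3 * x 0 * x 2 ^ 3 +
      7 / 6 * x 1 ^ 4 - x 1 ^ 2 * x 2 ^ 2 - 335 / 12 * x 2 ^ 4,
    -233 / 3 * x 0 ^ 3 * x 1 + 67 / 9 * x 0 ^ 3 * x 2 - 233 / 2 * x 0 ^ 2 * x 1 ^ 2 -
      235 * x 0 ^ 2 * x 1 * x 2 + 163 / 6 * x 0 ^ 2 * x 2 ^ 2 - 203 / 3 * x 0 * x 1 ^ 3 -
      225 * x 0 * x 1 ^ 2 * x 2 - 209 * x 0 * x 1 * x 2 ^ 2 + 301 / 9 * x 0 * x 2 ^ 3 -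
      64 / 3 * x 1 ^ 3 * x 2 - 21 * x 1 ^ 2 * x 2 ^ 2 - 16 / 3 * x 1 * x 2 ^ 3,
    -10 * x 0 ^ 3 * x 1 - 10 * x 0 ^ 3 * x 2 + x 0 ^ 2 * x 1 ^ 2 + 119 * x 0 ^ 2 * x 1 * x 2 -
      15 * x 0 ^ 2 * x 2 ^ 2 + 16 * x 0 * x 1 ^ 3 + 145 * x 0 * x 1 ^ 2 * x 2 +
      129 * x 0 * x 1 * x 2 ^ 2 + 16 * x 1 ^ 3 * x 2 + 11 * x 1 ^ 2 * x 2 ^ 2 -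
      29 / 4 * x 2 ^ 4]

theorem bHatQuartic_smul (r : ℝ) (w : R3) : bHatQuartic (r • w) = r ^ 4 • bHatQuartic w := by
  simp only [bHatQuartic, Pi.smul_apply, smul_eq_mul, Matrix.smul_cons, Matrix.smul_empty]
  congrm ![?_, ?_, ?_] <;> ring

theorem fwdDiff_iter_four_bHat (w y : R3) :
    (fwdDiff w)^[4] bHat y = (24 : ℝ) • bHatQuartic w := by
  rw [fwdDiff_iter_four]
  simp only [bHat, bHatQuartic, bHat1, bHat2, bHat3, Pi.add_apply, Pi.smul_apply,
    Matrix.smul_cons, Matrix.smul_empty, Matrix.cons_add_cons, Matrix.cons_sub_cons,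
    Matrix.empty_add_empty, Matrix.empty_sub_empty]
  congrm ![?_, ?_, ?_] <;> simp only [nsmul_eq_mul, smul_eq_mul, Nat.cast_ofNat] <;> ring

/-- The quartic part of the bubble `piolaBubble p`, as a function of the direction `w`. -/
def piolaQuartic (p : Fin 4 → R3) (w : R3) : R3 :=
  (jac p).mulVec (bHatQuartic ((jac p)⁻¹.mulVec w))

theorem piolaQuartic_smul (p : Fin 4 → R3) (r : ℝ) (w : R3) :
    piolaQuartic p (r • w) = r ^ 4 • piolaQuartic p w := by
  simp only [piolaQuartic, Matrix.mulVec_smul, bHatQuartic_smul]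

theorem fwdDiff_iter_four_piolaBubble (p : Fin 4 → R3) (w y : R3) :
    (fwdDiff w)^[4] (piolaBubble p) y = (24 : ℝ) • piolaQuartic p w := by
  have hshift : ∀ x, refMapInv p (x + w) = refMapInv p x + (jac p)⁻¹.mulVec w := fun x => by
    simp only [refMapInv, ← Matrix.mulVec_add, add_sub_right_comm]
  have h := fwdDiff_iter_map_comp hshift (jac p).mulVecLin.toAddMonoidHom bHat 4
  refine (congrFun h y).trans ?_
  rw [fwdDiff_iter_four_bHat]
  exact Matrix.mulVec_smul (jac p) 24 (bHatQuartic _)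

/-- The increments of the four barycentric coordinates along the reference direction `u`. -/
def baryDir (u : R3) : Fin 4 → ℝ := Fin.cons (-∑ j, u j) u

theorem baryDir_vec (a b c : ℝ) : baryDir ![a, b, c] = ![-(a + b + c), a, b, c] := by
  simp only [baryDir, Fin.sum_univ_three]
  rfl

theorem jac_mulVec_eq_edges (p : Fin 4 → R3) (u : R3) :
    (jac p).mulVec u = u 0 • (p 1 - p 0) + u 1 • (p 2 - p 0) + u 2 • (p 3 - p 0) := by
  ext r
  simp [jac, Matrix.mulVec, dotProduct, Fin.sum_univ_three, mul_comm]

theorem jac_mulVec (p : Fin 4 → R3) (u : R3) : (jac p).mulVec u = ∑ i, baryDir u i • p i := by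
  have hsucc : ∑ j : Fin 3, baryDir u j.succ • p j.succ = u 0 • p 1 + u 1 • p 2 + u 2 • p 3 :=
    Fin.sum_univ_three _
  rw [jac_mulVec_eq_edges, Fin.sum_univ_succ, hsucc, baryDir, Fin.cons_zero, Fin.sum_univ_three]
  module

theorem baryDir_baryDir_comp {σ : Fin 4 → Fin 4} (hσ : σ.Bijective) (u : R3) :
    baryDir (fun j => baryDir u (σ j.succ)) = baryDir u ∘ σ := by
  have hsum : ∑ i, baryDir u (σ i) = 0 := by
    rw [hσ.sum_comp (baryDir u), Fin.sum_univ_succ]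
    simp only [baryDir, Fin.cons_zero, Fin.cons_succ, neg_add_cancel]
  rw [Fin.sum_univ_succ] at hsum
  refine funext (Fin.cases ?_ fun j => rfl)
  exact (eq_neg_of_add_eq_zero_left hsum).symm

theorem jac_comp_inv_mulVec {p : Fin 4 → R3} (hp : AffineIndependent ℝ p) {σ : Fin 4 → Fin 4}
    (hσ : σ.Bijective) (u : R3) :
    (jac (p ∘ σ))⁻¹.mulVec ((jac p).mulVec u) = fun j => baryDir u (σ j.succ) := by
  have hdet : IsUnit (jac (p ∘ σ)).det := jac_det_isUnit (hp.comp_embedding ⟨σ, hσ.injective⟩)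
  have h : (jac p).mulVec u = (jac (p ∘ σ)).mulVec fun j => baryDir u (σ j.succ) := by
    rw [jac_mulVec, jac_mulVec, baryDir_baryDir_comp hσ]
    exact (hσ.sum_comp fun i => baryDir u i • p i).symm
  rw [h, Matrix.mulVec_mulVec, Matrix.nonsing_inv_mul _ hdet, Matrix.one_mulVec]

/-- The vertices of the reference tetrahedron. -/
def refVertex : Fin 4 → R3 := ![![0, 0, 0], ![1, 0, 0], ![0, 1, 0], ![0, 0, 1]]

theorem jac_mulVec_refVertex (p : Fin 4 → R3) (i : Fin 4) :
    (jac p).mulVec (refVertex i) = p i - p 0 := by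
  fin_cases i <;> simp [refVertex, jac_mulVec_eq_edges]

theorem jac_comp (p : Fin 4 → R3) (σ : Fin 4 → Fin 4) :
    jac (p ∘ σ) = jac p * jac (refVertex ∘ σ) := by
  ext r j
  calc p (σ j.succ) r - p (σ 0) r = (p (σ j.succ) - p 0) r - (p (σ 0) - p 0) r := by simp
    _ = (jac p).mulVec (refVertex (σ j.succ) - refVertex (σ 0)) r := by
      rw [Matrix.mulVec_sub, jac_mulVec_refVertex, jac_mulVec_refVertex, Pi.sub_apply _ (p _ - _)]

/-- The quartic part of the `i`-th bubble of the reference tetrahedron. -/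
def refQuartic (i : Fin 9) (u : R3) : R3 :=
  (jac (refVertex ∘ numbering i)).mulVec (bHatQuartic fun j => baryDir u (numbering i j.succ))

theorem numbering_bijective (i : Fin 9) : (numbering i).Bijective := by
  rw [← Finite.injective_iff_bijective]
  revert i
  decide

theorem piolaQuartic_comp_numbering {p : Fin 4 → R3} (hp : AffineIndependent ℝ p) (i : Fin 9)
    (u : R3) : piolaQuartic (p ∘ numbering i) ((jac p).mulVec u) =
      (jac p).mulVec (refQuartic i u) := by
  rw [piolaQuartic, jac_comp_inv_mulVec hp (numbering_bijective i), jac_comp, refQuartic,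
    Matrix.mulVec_mulVec]

theorem sum_smul_refQuartic_x (d : Fin 9 → ℝ) : ∑ i, d i • refQuartic i ![1, 0, 0] =
    ![263 / 12 * d 0 - 29 / 4 * d 1 - 7 / 6 * d 3 - 263 / 12 * d 4 + 211 / 6 * d 5 +
        173 / 6 * d 6 - 49 / 4 * d 7 - 49 / 4 * d 8,
      -335 / 12 * d 1 + 7 / 6 * d 3 - 647 / 12 * d 6 + 103 / 3 * d 7 - 247 / 18 * d 8,
      7 / 6 * d 2 - 335 / 12 * d 5 - 5 * d 6 - 111 / 4 * d 7 + 1805 / 36 * d 8] := by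
  simp only [refQuartic, jac_mulVec_eq_edges, baryDir_vec, bHatQuartic, Fin.sum_univ_succ]
  simp only [numbering, refVertex, Function.comp_apply, Matrix.cons_val, Fin.succ_zero_eq_one,
    Fin.succ_one_eq_two, Fin.reduceSucc, Matrix.smul_cons, Matrix.smul_empty,
    Matrix.cons_add_cons, Matrix.cons_sub_cons, Matrix.empty_add_empty, Matrix.empty_sub_empty,
    smul_eq_mul, Finset.univ_eq_empty, Finset.sum_empty, add_zero]
  congrm ![?_, ?_, ?_] <;> ring

theorem sum_smul_refQuartic_xz (d : Fin 9 → ℝ) : ∑ i, d i • refQuartic i ![-1, 0, 1] =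
    ![-145 / 6 * d 0 - 49 / 4 * d 1 + 173 / 6 * d 2 + 211 / 6 * d 3 - 7 / 6 * d 4 -
        263 / 12 * d 5 + 17 / 3 * d 6 - 49 / 4 * d 7 - 29 / 4 * d 8,
      -247 / 18 * d 0 - 111 / 4 * d 1 - 5 * d 2 - 335 / 12 * d 3 + 103 / 3 * d 6 +
        1805 / 36 * d 7,
      -49 / 4 * d 0 + 17 / 3 * d 1 + 361 / 12 * d 2 - 29 / 4 * d 3 + 263 / 12 * d 5 -
        49 / 4 * d 6 - 145 / 6 * d 7 + 211 / 6 * d 8] := by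
  simp only [refQuartic, jac_mulVec_eq_edges, baryDir_vec, bHatQuartic, Fin.sum_univ_succ]
  simp only [numbering, refVertex, Function.comp_apply, Matrix.cons_val, Fin.succ_zero_eq_one,
    Fin.succ_one_eq_two, Fin.reduceSucc, Matrix.smul_cons, Matrix.smul_empty,
    Matrix.cons_add_cons, Matrix.cons_sub_cons, Matrix.empty_add_empty, Matrix.empty_sub_empty,
    smul_eq_mul, Finset.univ_eq_empty, Finset.sum_empty, add_zero]
  congrm ![?_, ?_, ?_] <;> ring

theorem sum_smul_refQuartic_xy (d : Fin 9 → ℝ) : ∑ i, d i • refQuartic i ![-1, 1, 0] =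
    ![361 / 12 * d 0 - 49 / 4 * d 1 + 17 / 3 * d 2 - 263 / 12 * d 3 + 211 / 6 * d 4 -
        7 / 6 * d 5 - 29 / 4 * d 7 - 49 / 4 * d 8,
      173 / 6 * d 0 - 145 / 6 * d 1 - 49 / 4 * d 2 + 263 / 12 * d 3 - 29 / 4 * d 4 -
        7 / 6 * d 6 + 211 / 6 * d 7 + 17 / 3 * d 8,
      -5 * d 0 - 247 / 18 * d 1 - 111 / 4 * d 2 + 7 / 6 * d 5 - 335 / 12 * d 7 +
        103 / 3 * d 8] := by
  simp only [refQuartic, jac_mulVec_eq_edges, baryDir_vec, bHatQuartic, Fin.sum_univ_succ]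
  simp only [numbering, refVertex, Function.comp_apply, Matrix.cons_val, Fin.succ_zero_eq_one,
    Fin.succ_one_eq_two, Fin.reduceSucc, Matrix.smul_cons, Matrix.smul_empty,
    Matrix.cons_add_cons, Matrix.cons_sub_cons, Matrix.empty_add_empty, Matrix.empty_sub_empty,
    smul_eq_mul, Finset.univ_eq_empty, Finset.sum_empty, add_zero]
  congrm ![?_, ?_, ?_] <;> ring

theorem linearIndependent_refQuartic : LinearIndependent ℝ refQuartic := by
  refine Fintype.linearIndependent_iff.2 fun d h => ?_
  have hdir : ∀ u, ∑ i, d i • refQuartic i u = 0 := fun u => by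
    simpa only [Finset.sum_apply, Pi.smul_apply, Pi.zero_apply] using congrFun h u
  -- The edges at the vertex `(1, 0, 0)` already give nine equations of full rank.
  obtain ⟨e₁, e₂, e₃⟩ : _ ∧ _ ∧ _ := by
    simpa using (sum_smul_refQuartic_x d).symm.trans (hdir _)
  obtain ⟨e₄, e₅, e₆⟩ : _ ∧ _ ∧ _ := by
    simpa using (sum_smul_refQuartic_xz d).symm.trans (hdir _)
  obtain ⟨e₇, e₈, e₉⟩ : _ ∧ _ ∧ _ := by
    simpa using (sum_smul_refQuartic_xy d).symm.trans (hdir _)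
  clear h hdir
  intro i
  fin_cases i <;> simp only [Fin.zero_eta, Fin.mk_one, Fin.reduceFinMk] <;> grind

theorem linearIndependent_piolaQuartic {p : Fin 4 → R3} (hp : AffineIndependent ℝ p) :
    LinearIndependent ℝ fun i => piolaQuartic (p ∘ numbering i) := by
  refine Fintype.linearIndependent_iff.2 fun d h => ?_
  refine Fintype.linearIndependent_iff.1 linearIndependent_refQuartic d (funext fun u => ?_)
  refine Matrix.eq_zero_of_mulVec_eq_zero (jac_det_isUnit hp).ne_zero ?_
  simpa only [Finset.sum_apply, Pi.smul_apply, piolaQuartic_comp_numbering hp, Matrix.mulVec_sum,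
    Matrix.mulVec_smul, Pi.zero_apply] using congrFun h ((jac p).mulVec u)

end QuarticPart

section Barycentric

theorem exists_perm_apply_eq_of_mem_range {ι α : Type*} [Finite ι] {p q : ι → α}
    (hp : p.Injective) (hq : q.Injective) :
    ∃ e : Equiv.Perm ι, ∀ i, p i ∈ Set.range q → q (e i) = p i := by
  classical
  let f : {i // p i ∈ Set.range q} → {j // q j ∈ Set.range p} :=
    fun i => ⟨i.2.choose, i, i.2.choose_spec.symm⟩
  have hf : ∀ i, q (f i) = p i := fun i => i.2.choose_spec
  have hbij : f.Bijective := by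
    refine ⟨fun a b hab => Subtype.ext (hp ?_), fun ⟨j, i, hij⟩ =>
      ⟨⟨i, j, hij.symm⟩, Subtype.ext (hq ((hf _).trans hij))⟩⟩
    rw [← hf a, ← hf b, hab]
  refine ⟨(Equiv.ofBijective f hbij).extendSubtype, fun i hi => ?_⟩
  rw [Equiv.extendSubtype_apply_of_mem _ i hi]
  exact hf ⟨i, hi⟩

variable {p q : Fin 4 → R3}

/-- The vertices of a nondegenerate tetrahedron as an affine basis, whose coordinates are the
functions `bary p`. -/
def vertexBasis (p : Fin 4 → R3) (hp : AffineIndependent ℝ p) : AffineBasis (Fin 4) ℝ R3 :=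
  ⟨p, hp, by rw [hp.affineSpan_eq_top_iff_card_eq_finrank_add_one]; simp⟩

theorem sum_bary (p : Fin 4 → R3) (x : R3) : ∑ i, bary p i x = 1 := by
  simp only [bary, Fin.sum_univ_succ (n := 3), Fin.cons_zero, Fin.cons_succ, sub_add_cancel]

theorem sum_bary_smul (hp : AffineIndependent ℝ p) (x : R3) : ∑ i, bary p i x • p i = x := by
  have hbary : ∀ i, bary p i x = (if i = 0 then 1 else 0) + baryDir (refMapInv p x) i :=
    Fin.cases (by simp [bary, baryDir, sub_eq_add_neg]) fun j => by simp [bary, baryDir]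
  calc ∑ i, bary p i x • p i = refMap p (refMapInv p x) := by
        simp [hbary, add_smul, sum_add_distrib, refMap, jac_mulVec]
    _ = x := refMap_refMapInv hp x

theorem bary_eq_of_sum (hp : AffineIndependent ℝ p) {w : Fin 4 → ℝ} (hw : ∑ i, w i = 1)
    (j : Fin 4) : bary p j (∑ i, w i • p i) = w j := by
  refine congrFun ((affineIndependent_iff_eq_of_fintype_affineCombination_eq ℝ p).1 hp
    (fun i => bary p i (∑ i, w i • p i)) w (sum_bary p _) hw ?_) j
  rw [affineCombination_eq_linear_combination _ _ _ (sum_bary p _),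
    affineCombination_eq_linear_combination _ _ _ hw, sum_bary_smul hp]

theorem bary_eq_coord (hp : AffineIndependent ℝ p) (i : Fin 4) :
    bary p i = (vertexBasis p hp).coord i := by
  funext x
  conv_lhs => rw [← (vertexBasis p hp).linear_combination_coord_eq_self x]
  exact bary_eq_of_sum hp ((vertexBasis p hp).sum_coord_apply_eq_one x) i

theorem mem_convexHull_iff_bary (hp : AffineIndependent ℝ p) {x : R3} :
    x ∈ convexHull ℝ (Set.range p) ↔ ∀ i, 0 ≤ bary p i x := by
  simp only [bary_eq_coord hp]
  exact Set.ext_iff.1 (vertexBasis p hp).convexHull_eq_nonneg_coord x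

theorem mem_interior_convexHull_iff_bary (hp : AffineIndependent ℝ p) {x : R3} :
    x ∈ interior (convexHull ℝ (Set.range p)) ↔ ∀ i, 0 < bary p i x := by
  simp only [bary_eq_coord hp]
  exact Set.ext_iff.1 (vertexBasis p hp).interior_convexHull x

theorem bary_eq_zero_of_mem_convexHull (hp : AffineIndependent ℝ p) {s : Set R3}
    (hs : s ⊆ Set.range p) {i : Fin 4} (hi : p i ∉ s) {x : R3} (hx : x ∈ convexHull ℝ s) :
    bary p i x = 0 := by
  rw [bary_eq_coord hp]
  refine convexHull_min (t := (vertexBasis p hp).coord i ⁻¹' {0}) (fun v hv => ?_)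
    ((convex_singleton 0).affine_preimage _) hx
  obtain ⟨j, rfl⟩ := hs hv
  exact (vertexBasis p hp).coord_apply_ne fun hij => hi (hij ▸ hv)

theorem bary_eq_of_mem_convexHull_inter (hp : AffineIndependent ℝ p) (hq : AffineIndependent ℝ q)
    {e : Equiv.Perm (Fin 4)} (he : ∀ i, p i ∈ Set.range q → q (e i) = p i) {x : R3}
    (hx : x ∈ convexHull ℝ (Set.range p ∩ Set.range q)) (i : Fin 4) :
    bary q (e i) x = bary p i x := by
  have hsum : ∑ j, bary p (e.symm j) x • q j = x := calc
    _ = ∑ i, bary p i x • q (e i) := by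
      rw [← Equiv.sum_comp e]
      simp only [Equiv.symm_apply_apply]
    _ = ∑ i, bary p i x • p i := Fintype.sum_congr _ _ fun i => by
      by_cases hi : p i ∈ Set.range q
      · rw [he i hi]
      · simp only [bary_eq_zero_of_mem_convexHull hp Set.inter_subset_left (mt And.right hi) hx,
          zero_smul]
    _ = x := sum_bary_smul hp x
  have hw : ∑ j, bary p (e.symm j) x = 1 :=
    (Equiv.sum_comp e.symm (bary p · x)).trans (sum_bary p x)
  conv_lhs => rw [← hsum, bary_eq_of_sum hq hw, Equiv.symm_apply_apply]

theorem contDiff_refMapInv (p : Fin 4 → R3) {n : WithTop ℕ∞} : ContDiff ℝ n (refMapInv p) :=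
  (Matrix.mulVecLin (jac p)⁻¹).toContinuousLinearMap.contDiff.comp
    (contDiff_id.sub contDiff_const)

theorem contDiff_bary (p : Fin 4 → R3) (i : Fin 4) {n : WithTop ℕ∞} : ContDiff ℝ n (bary p i) := by
  have h : ∀ j, ContDiff ℝ n fun x => refMapInv p x j := contDiff_pi.1 (contDiff_refMapInv p)
  exact Fin.cases (contDiff_const.sub (ContDiff.sum fun j _ => h j)) h i

end Barycentric

section CubicLagrange

variable {p q : Fin 4 → R3} {k l : Fin 4 → ℕ} {x : R3}

theorem mem_multiIdx : k ∈ multiIdx ↔ ∑ i, k i = 3 :=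
  Finset.Nat.mem_antidiagonalTuple

theorem localNodal_eq_zero_of_bary_eq_zero {i : Fin 4} (hk : k i ≠ 0) (hx : bary p i x = 0) :
    localNodal p k x = 0 := by
  refine prod_eq_zero (mem_univ i) (prod_eq_zero (mem_range.2 (Nat.pos_of_ne_zero hk)) ?_)
  simp only [hx, mul_zero, Nat.cast_zero, sub_zero, zero_div]

theorem localNode_comp_symm_eq {e : Equiv.Perm (Fin 4)}
    (he : ∀ i, k i ≠ 0 → q (e i) = p i) : localNode q (k ∘ e.symm) = localNode p k := by
  unfold localNode
  rw [← Equiv.sum_comp e]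
  refine Fintype.sum_congr _ _ fun i => ?_
  simp only [Function.comp_apply, Equiv.symm_apply_apply]
  by_cases hk : k i = 0
  · simp only [hk, Nat.cast_zero, zero_div, zero_smul]
  · rw [he i hk]

theorem localNodal_comp_symm_eq {e : Equiv.Perm (Fin 4)} (he : ∀ i, bary q (e i) x = bary p i x)
    (k : Fin 4 → ℕ) : localNodal q (k ∘ e.symm) x = localNodal p k x := by
  unfold localNodal
  rw [← Equiv.prod_comp e]
  simp only [Function.comp_apply, Equiv.symm_apply_apply, he]

open Classical in
theorem sum_localNodal_eq (hp : AffineIndependent ℝ p) (hq : AffineIndependent ℝ q)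
    (hx : x ∈ convexHull ℝ (Set.range p ∩ Set.range q)) (a : R3) :
    ∑ k ∈ multiIdx with localNode p k = a, localNodal p k x =
      ∑ k ∈ multiIdx with localNode q k = a, localNodal q k x := by
  obtain ⟨e, he⟩ := exists_perm_apply_eq_of_mem_range hp.injective hq.injective
  have hbary := bary_eq_of_mem_convexHull_inter hp hq he hx
  rw [sum_filter, sum_filter]
  refine sum_equiv (e.arrowCongr (Equiv.refl ℕ)) (fun k => ?_) fun k _ => ?_
  · rw [mem_multiIdx, mem_multiIdx]
    exact Eq.congr_left (Equiv.sum_comp e.symm k).symm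
  · change _ = if localNode q (k ∘ e.symm) = a then localNodal q (k ∘ e.symm) x else 0
    rw [localNodal_comp_symm_eq hbary]
    by_cases h0 : localNodal p k x = 0
    · simp only [h0, ite_self]
    rw [localNode_comp_symm_eq fun i hk => he i ?_]
    by_contra hi
    exact h0 (localNodal_eq_zero_of_bary_eq_zero hk
      (bary_eq_zero_of_mem_convexHull hp Set.inter_subset_left (mt And.right hi) hx))

theorem bary_localNode (hp : AffineIndependent ℝ p) (hk : k ∈ multiIdx) (i : Fin 4) :
    bary p i (localNode p k) = (k i : ℝ) / 3 := by
  refine bary_eq_of_sum hp (w := fun i => (k i : ℝ) / 3) ?_ i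
  rw [← sum_div, ← Nat.cast_sum, mem_multiIdx.1 hk, Nat.cast_ofNat, div_self three_ne_zero]

theorem prod_range_sub_div_eq_choose {K : Type*} [Field K] [CharZero K] (k n : ℕ) :
    ∏ m ∈ range n, ((k : K) - m) / (m + 1) = k.choose n := by
  rw [prod_div_distrib, Nat.cast_choose_eq_descPochhammer_div, descPochhammer_eval_eq_prod_range,
    ← prod_range_add_one_eq_factorial, Nat.cast_prod]
  simp only [Nat.cast_add, Nat.cast_one]

theorem localNodal_localNode (hp : AffineIndependent ℝ p) (hk : k ∈ multiIdx)
    (hl : l ∈ multiIdx) : localNodal p l (localNode p k) = if l = k then 1 else 0 := by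
  have hchoose : localNodal p l (localNode p k) = ∏ i, ((k i).choose (l i) : ℝ) :=
    Fintype.prod_congr _ _ fun i => by
      simp only [bary_localNode hp hk, mul_div_cancel₀ _ (three_ne_zero' ℝ),
        prod_range_sub_div_eq_choose]
  rw [hchoose]
  split_ifs with h
  · simp only [h, Nat.choose_self, Nat.cast_one, prod_const_one]
  · obtain ⟨i, hi⟩ : ∃ i, k i < l i := by
      by_contra! hle
      have hs : ∑ i, l i = ∑ i, k i := (mem_multiIdx.1 hl).trans (mem_multiIdx.1 hk).symm
      exact h (funext fun i =>
        (sum_eq_sum_iff_of_le fun i _ => hle i).1 hs i (mem_univ i))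
    exact prod_eq_zero (mem_univ i) (by rw [Nat.choose_eq_zero_of_lt hi, Nat.cast_zero])

theorem contDiff_localNodal (p : Fin 4 → R3) (k : Fin 4 → ℕ) {n : WithTop ℕ∞} :
    ContDiff ℝ n (localNodal p k) := by
  unfold localNodal
  have := fun i => contDiff_bary p i (n := n)
  fun_prop

theorem fwdDiff_iter_four_localNodal (hp : AffineIndependent ℝ p) (hk : k ∈ multiIdx) (w : R3) :
    (fwdDiff w)^[4] (localNodal p k) = 0 := by
  let A : (Σ _ : Fin 4, ℕ) → R3 →ᵃ[ℝ] ℝ := fun im =>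
    ((im.2 : ℝ) + 1)⁻¹ • ((3 : ℝ) • (vertexBasis p hp).coord im.1 - AffineMap.const ℝ R3 (im.2 : ℝ))
  have hprod : localNodal p k = fun x => ∏ im ∈ univ.sigma fun i => range (k i), A im x := by
    funext x
    simp only [localNodal, prod_sigma', bary_eq_coord hp]
    refine prod_congr rfl fun im _ => ?_
    exact div_eq_inv_mul _ _
  rw [hprod]
  refine fwdDiff_iter_prod_affineMap _ A ?_ w
  simp only [card_sigma, card_range, mem_multiIdx.1 hk, Nat.lt_add_one]

end CubicLagrange

section LocalField

variable {p : Fin 4 → R3}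

theorem contDiff_bHat {n : WithTop ℕ∞} : ContDiff ℝ n bHat := by
  refine contDiff_pi.2 fun i => ?_
  fin_cases i <;>
    simp only [bHat, bHat1, bHat2, bHat3, Fin.zero_eta, Fin.mk_one, Fin.reduceFinMk,
      Matrix.cons_val] <;>
    fun_prop

theorem contDiff_piolaBubble (p : Fin 4 → R3) {n : WithTop ℕ∞} : ContDiff ℝ n (piolaBubble p) :=
  (Matrix.mulVecLin (jac p)).toContinuousLinearMap.contDiff.comp
    (contDiff_bHat.comp (contDiff_refMapInv p))

/-- The cubic vector field on the tetrahedron `p` with the nodal values `c`. -/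
def cubicInterpolant (p : Fin 4 → R3) (c : multiIdx → R3) (x : R3) : R3 :=
  ∑ k : multiIdx, localNodal p k x • c k

/-- The polynomial that a function of the discrete space equals on one tetrahedron: a cubic
vector field plus a combination of the nine bubbles. -/
def localField (p : Fin 4 → R3) (c : multiIdx → R3) (d : Fin 9 → ℝ) : R3 → R3 :=
  cubicInterpolant p c + ∑ i, d i • piolaBubble (p ∘ numbering i)

theorem contDiff_cubicInterpolant (p : Fin 4 → R3) (c : multiIdx → R3) {n : WithTop ℕ∞} :
    ContDiff ℝ n (cubicInterpolant p c) :=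
  ContDiff.sum fun _ _ => (contDiff_localNodal _ _).smul contDiff_const

theorem contDiff_localField (p : Fin 4 → R3) (c : multiIdx → R3) (d : Fin 9 → ℝ)
    {n : WithTop ℕ∞} : ContDiff ℝ n (localField p c d) := by
  rw [localField, Finset.sum_fn]
  exact (contDiff_cubicInterpolant p c).add
    (ContDiff.sum fun i _ => (contDiff_piolaBubble _).const_smul (d i))

theorem cubicInterpolant_localNode (hp : AffineIndependent ℝ p) (c : multiIdx → R3)
    (k : multiIdx) : cubicInterpolant p c (localNode p k) = c k := by
  simp only [cubicInterpolant, localNodal_localNode hp k.2 (Subtype.prop _), ← Subtype.ext_iff,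
    ite_smul, one_smul, zero_smul, sum_ite_eq', mem_univ, if_true]

theorem fwdDiff_iter_four_cubicInterpolant (hp : AffineIndependent ℝ p) (c : multiIdx → R3)
    (w : R3) : (fwdDiff w)^[4] (cubicInterpolant p c) = 0 := by
  have hterm : ∀ k : multiIdx, (fwdDiff w)^[4] (fun x => localNodal p k x • c k) = 0 := fun k => by
    have h := fwdDiff_iter_map_comp (g := id) (fun x => rfl)
      ((LinearMap.toSpanSingleton ℝ R3 (c k)).toAddMonoidHom) (localNodal p k) 4 (w := w)
    rw [fwdDiff_iter_four_localNodal hp k.2] at h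
    exact h.trans (funext fun _ => zero_smul ℝ (c k))
  have hsum : cubicInterpolant p c = ∑ k : multiIdx, fun x => localNodal p k x • c k := by
    funext x
    rw [cubicInterpolant, Finset.sum_apply]
  rw [hsum, fwdDiff_iter_finsetSum]
  exact sum_eq_zero fun k _ => hterm k

theorem fwdDiff_iter_four_localField (hp : AffineIndependent ℝ p) (c : multiIdx → R3)
    (d : Fin 9 → ℝ) (w y : R3) : (fwdDiff w)^[4] (localField p c d) y =
      (24 : ℝ) • ∑ i, d i • piolaQuartic (p ∘ numbering i) w := by
  simp only [localField, fwdDiff_iter_add, fwdDiff_iter_finsetSum, fwdDiff_iter_const_smul,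
    fwdDiff_iter_four_cubicInterpolant hp, Pi.add_apply, Finset.sum_apply, Pi.smul_apply,
    fwdDiff_iter_four_piolaBubble, zero_add, smul_sum, smul_comm (24 : ℝ), Pi.zero_apply]

theorem eq_zero_of_eventually_localField_eq (hp : AffineIndependent ℝ p) {c : multiIdx → R3}
    {d : Fin 9 → ℝ} {y a : R3} (h : ∀ᶠ x in 𝓝 y, localField p c d x = a) : d = 0 := by
  let Q : R3 → R3 := fun w => ∑ i, d i • piolaQuartic (p ∘ numbering i) w
  have hsmul : ∀ (r : ℝ) w, Q (r • w) = r ^ 4 • Q w := fun r w => by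
    simp only [Q, piolaQuartic_smul, smul_sum, smul_comm (r ^ 4)]
  have hnear : ∀ᶠ w in 𝓝 0, Q w = 0 := by
    filter_upwards [eventually_fwdDiff_iter_eq_zero h four_ne_zero] with w hw
    rw [fwdDiff_iter_four_localField hp] at hw
    exact (smul_eq_zero_iff_right (by norm_num)).1 hw
  have hall : ∀ w, Q w = 0 := fun w => by
    have hray : Tendsto (fun r : ℝ => r • w) (𝓝[≠] 0) (𝓝 0) :=
      ((continuous_id.smul continuous_const).tendsto' 0 0 (zero_smul ℝ w)).mono_left
        nhdsWithin_le_nhds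
    obtain ⟨r, hr, hr0⟩ := ((hray.eventually hnear).and self_mem_nhdsWithin).exists
    rw [hsmul] at hr
    exact (smul_eq_zero_iff_right (pow_ne_zero 4 hr0)).1 hr
  refine funext (Fintype.linearIndependent_iff.1 (linearIndependent_piolaQuartic hp) d ?_)
  funext w
  simpa only [Finset.sum_apply, Pi.smul_apply, Pi.zero_apply] using hall w

end LocalField

namespace TetMesh

section Mesh

variable {n : ℕ} (M : TetMesh n)

theorem mem_interior_tet_iff {t : Fin n} {x : R3} :
    x ∈ interior (M.tet t) ↔ ∀ i, 0 < bary (M.vert t) i x :=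
  mem_interior_convexHull_iff_bary (M.affineIndependent t)

theorem isCompact_tet (t : Fin n) : IsCompact (M.tet t) :=
  (Set.finite_range (M.vert t)).isCompact_convexHull ℝ

theorem convex_tet (t : Fin n) : Convex ℝ (M.tet t) := convex_convexHull ℝ _

theorem isBounded_interior_tet (t : Fin n) : Bornology.IsBounded (interior (M.tet t)) :=
  (M.isCompact_tet t).isBounded.subset interior_subset

theorem nonempty_interior_tet (t : Fin n) : (interior (M.tet t)).Nonempty :=
  ⟨_, (vertexBasis _ (M.affineIndependent t)).centroid_mem_interior_convexHull⟩

theorem closure_interior_tet (t : Fin n) : closure (interior (M.tet t)) = M.tet t := by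
  rw [(M.convex_tet t).closure_interior_eq_closure_of_nonempty_interior (𝕜 := ℝ)
    (M.nonempty_interior_tet t), (M.isCompact_tet t).isClosed.closure_eq]

theorem notMem_tet_of_mem_interior {s t : Fin n} (hst : s ≠ t) {x : R3}
    (hx : x ∈ interior (M.tet t)) : x ∉ M.tet s := by
  intro hs
  have hmem : x ∈ convexHull ℝ (Set.range (M.vert t) ∩ Set.range (M.vert s)) := by
    rw [← M.conforming]
    exact ⟨interior_subset hx, hs⟩
  have hsub : Set.range (M.vert t) ⊆ Set.range (M.vert s) := by
    rintro _ ⟨i, rfl⟩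
    by_contra hi
    exact (M.mem_interior_tet_iff.1 hx i).ne' (bary_eq_zero_of_mem_convexHull
      (M.affineIndependent t) Set.inter_subset_left (mt And.right hi) hmem)
  obtain ⟨e, he⟩ := exists_perm_apply_eq_of_mem_range (M.affineIndependent t).injective
    (M.affineIndependent s).injective
  have hvert : M.vert s ∘ e = M.vert t := funext fun i => he i (hsub ⟨i, rfl⟩)
  refine hst (M.distinct ?_)
  change Set.range (M.vert s) = Set.range (M.vert t)
  rw [← hvert, e.surjective.range_comp]

open Classical in
theorem nodal_eq {t : Fin n} {x : R3} (hx : x ∈ M.tet t) (a : R3) :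
    M.nodal a x = ∑ k ∈ multiIdx with localNode (M.vert t) k = a, localNodal (M.vert t) k x := by
  have h : ∃ t, x ∈ M.tet t := ⟨t, hx⟩
  rw [nodal, dif_pos h]
  refine sum_localNodal_eq (M.affineIndependent _) (M.affineIndependent _) ?_ a
  rw [← M.conforming]
  exact ⟨h.choose_spec, hx⟩

theorem localNode_mem_nodes (t : Fin n) {k : Fin 4 → ℕ} (hk : k ∈ multiIdx) :
    localNode (M.vert t) k ∈ M.nodes :=
  mem_biUnion.2 ⟨t, mem_univ t, mem_image_of_mem _ hk⟩

theorem exists_localNode_eq (a : M.nodes) :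
    ∃ (t : Fin n) (k : multiIdx), localNode (M.vert t) k = a := by
  obtain ⟨t, -, hk⟩ := mem_biUnion.1 a.2
  obtain ⟨k, hk, hka⟩ := mem_image.1 hk
  exact ⟨t, ⟨k, hk⟩, hka⟩

theorem localNode_mem_tet (t : Fin n) {k : Fin 4 → ℕ} (hk : k ∈ multiIdx) :
    localNode (M.vert t) k ∈ M.tet t := by
  refine (mem_convexHull_iff_bary (M.affineIndependent t)).2 fun i => ?_
  rw [bary_localNode (M.affineIndependent t) hk]
  positivity

/-- The coefficients `c` at the twenty nodes of the tetrahedron `t`. -/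
def nodalValues (c : M.nodes → Fin 3 → ℝ) (t : Fin n) : multiIdx → R3 :=
  fun k => c ⟨localNode (M.vert t) k, M.localNode_mem_nodes t k.2⟩

theorem eqOn_cubicInterpolant (c : M.nodes → Fin 3 → ℝ) (t : Fin n) :
    Set.EqOn (M.conformingPart c) (cubicInterpolant (M.vert t) (M.nodalValues c t))
      (M.tet t) := by
  classical
  intro x hx
  have hvec : M.conformingPart c x = ∑ a : M.nodes, M.nodal a x • c a := by
    ext m
    simp [conformingPart, Finset.sum_apply, Pi.single_apply, mul_comm]
  have hnodal : ∀ a : M.nodes, M.nodal a x • c a = ∑ k : multiIdx,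
      if (⟨_, M.localNode_mem_nodes t k.2⟩ : M.nodes) = a
        then localNodal (M.vert t) k x • c a else 0 := fun a => by
    rw [M.nodal_eq hx, sum_filter, sum_smul, ← sum_coe_sort multiIdx]
    simp only [Subtype.ext_iff, ite_smul, zero_smul]
  rw [hvec, Fintype.sum_congr _ _ hnodal, sum_comm]
  simp only [sum_ite_eq, mem_univ, if_true, cubicInterpolant, nodalValues]

theorem conformingPart_node (c : M.nodes → Fin 3 → ℝ) (a : M.nodes) :
    M.conformingPart c a = c a := by
  obtain ⟨t, k, hk⟩ := M.exists_localNode_eq a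
  calc M.conformingPart c a = M.conformingPart c (localNode (M.vert t) k) := by rw [hk]
    _ = M.nodalValues c t k := by
      rw [M.eqOn_cubicInterpolant c t (M.localNode_mem_tet t k.2),
        cubicInterpolant_localNode (M.affineIndependent t)]
    _ = c a := congrArg c (Subtype.ext hk)

theorem eqOn_localField (c : M.nodes → Fin 3 → ℝ) (d : Fin n → Fin 9 → ℝ) (t : Fin n) :
    Set.EqOn (M.conformingPart c + M.bubblePart d)
      (localField (M.vert t) (M.nodalValues c t) (d t)) (interior (M.tet t)) := by
  intro x hx
  have hother : ∀ s, s ≠ t → ∀ i, M.bubble s i x = 0 := fun s hs _ =>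
    Set.indicator_of_notMem (M.notMem_tet_of_mem_interior hs hx) _
  have hown : ∀ i, M.bubble t i x = piolaBubble (M.vert t ∘ numbering i) x := fun _ =>
    Set.indicator_of_mem (interior_subset hx) _
  have hbubble : M.bubblePart d x = ∑ i, d t i • M.bubble t i x := by
    simp only [bubblePart, Finset.sum_apply, Pi.smul_apply]
    exact Fintype.sum_eq_single t fun s hs =>
      sum_eq_zero fun i _ => by rw [hother s hs, smul_zero]
  simp only [localField, Pi.add_apply, M.eqOn_cubicInterpolant c t (interior_subset hx), hbubble,
    hown, Finset.sum_apply, Pi.smul_apply]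

end Mesh

section Energy

open MeasureTheory

variable {n : ℕ} (M : TetMesh n)

theorem gradForm_eq_sum_gradDot (u v : R3 → R3) :
    M.gradForm u v = ∑ t, ∫ x in interior (M.tet t), gradDot u v x := rfl

theorem gradForm_comm (u v : R3 → R3) : M.gradForm u v = M.gradForm v u := by
  simp only [gradForm_eq_sum_gradDot, gradDot_comm u v]

theorem gradForm_self_nonneg (u : R3 → R3) : 0 ≤ M.gradForm u u :=
  sum_nonneg fun _ _ => integral_nonneg (gradDot_self_nonneg u)

variable {M} {u v w : R3 → R3}

theorem gradForm_add_left (hu : ∀ t, HasC1Extension u (interior (M.tet t)))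
    (hv : ∀ t, HasC1Extension v (interior (M.tet t)))
    (hw : ∀ t, HasC1Extension w (interior (M.tet t))) :
    M.gradForm (u + v) w = M.gradForm u w + M.gradForm v w := by
  simp only [gradForm_eq_sum_gradDot, ← sum_add_distrib]
  exact Fintype.sum_congr _ _ fun t => (hu t).setIntegral_gradDot_add_left isOpen_interior
    (M.isBounded_interior_tet t) (hv t) (hw t)

theorem gradForm_smul_left (hu : ∀ t, HasC1Extension u (interior (M.tet t))) (r : ℝ)
    (w : R3 → R3) : M.gradForm (r • u) w = r * M.gradForm u w := by
  simp only [gradForm_eq_sum_gradDot, mul_sum]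
  exact Fintype.sum_congr _ _ fun t => (hu t).setIntegral_gradDot_smul_left isOpen_interior r w

theorem exists_eq_const_of_gradForm_self (hu : ∀ t, HasC1Extension u (interior (M.tet t)))
    (h : M.gradForm u u = 0) (t : Fin n) : ∃ a, ∀ x ∈ interior (M.tet t), u x = a :=
  (hu t).exists_eq_const_of_setIntegral_gradDot_self isOpen_interior
    (M.convex_tet t).interior.isPreconnected (M.isBounded_interior_tet t)
    ((sum_eq_zero_iff_of_nonneg fun _ _ => integral_nonneg (gradDot_self_nonneg u)).1 h t
      (mem_univ t))

theorem hasC1Extension_of_mem_Vh (hv : v ∈ M.Vh) (t : Fin n) :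
    HasC1Extension v (interior (M.tet t)) := by
  obtain ⟨c, d, -, rfl⟩ := hv
  exact ⟨_, contDiff_localField _ _ _, M.eqOn_localField c d t⟩

end Energy

section Coefficients

variable {n : ℕ} {M : TetMesh n} {c c' : M.nodes → Fin 3 → ℝ} {d d' : Fin n → Fin 9 → ℝ}

theorem conformingPart_sub (c c' : M.nodes → Fin 3 → ℝ) :
    M.conformingPart (c - c') = M.conformingPart c - M.conformingPart c' := by
  simp only [conformingPart, Pi.sub_apply, sub_smul, sum_sub_distrib]

theorem bubblePart_sub (d d' : Fin n → Fin 9 → ℝ) :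
    M.bubblePart (d - d') = M.bubblePart d - M.bubblePart d' := by
  simp only [bubblePart, Pi.sub_apply, sub_smul, sum_sub_distrib]

theorem conformingPart_zero : M.conformingPart 0 = 0 := by
  simpa only [sub_self] using conformingPart_sub (M := M) 0 0

theorem bubblePart_zero : M.bubblePart 0 = 0 := by
  simpa only [sub_self] using bubblePart_sub (M := M) 0 0

theorem Admissible.sub (hc : M.Admissible c) (hc' : M.Admissible c') : M.Admissible (c - c') :=
  fun x hx => by rw [conformingPart_sub, Pi.sub_apply, hc x hx, hc' x hx, sub_zero]

theorem bubbleCoeff_eq_zero (h : ∀ t, ∃ a, ∀ x ∈ interior (M.tet t),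
    (M.conformingPart c + M.bubblePart d) x = a) : d = 0 := by
  funext t
  obtain ⟨a, ha⟩ := h t
  obtain ⟨y, hy⟩ := M.nonempty_interior_tet t
  refine eq_zero_of_eventually_localField_eq (M.affineIndependent t) (c := M.nodalValues c t)
    (y := y) (a := a) ?_
  filter_upwards [isOpen_interior.mem_nhds hy] with x hx
  rw [← M.eqOn_localField c d t hx, ha x hx]

theorem conformingCoeff_eq_zero (hc : M.Admissible c)
    (h : ∀ t, ∃ a, ∀ x ∈ interior (M.tet t), M.conformingPart c x = a) : c = 0 := by
  have hconst : ∀ t, ∃ a, ∀ x ∈ M.tet t, M.conformingPart c x = a := fun t => by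
    obtain ⟨a, ha⟩ := h t
    have hcont : ContinuousOn (M.conformingPart c) (M.tet t) :=
      (contDiff_cubicInterpolant _ _ (n := 0)).continuous.continuousOn.congr
        (M.eqOn_cubicInterpolant c t)
    have heq : Set.EqOn (M.conformingPart c) (fun _ => a) (M.tet t) :=
      Set.EqOn.of_subset_closure ha hcont continuousOn_const interior_subset
        (M.closure_interior_tet t).ge
    exact ⟨a, heq⟩
  funext a
  obtain ⟨t, k, hk⟩ := M.exists_localNode_eq a
  rw [← M.conformingPart_node c a]
  exact eq_zero_of_const_on_cells M.isCompact_tet (fun t => (M.closure_interior_tet t).ge) hconst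
    hc (hk ▸ M.localNode_mem_tet t k.2)

theorem eq_zero_of_gradForm_self (hc : M.Admissible c)
    (h : M.gradForm (M.conformingPart c + M.bubblePart d)
      (M.conformingPart c + M.bubblePart d) = 0) : c = 0 ∧ d = 0 := by
  have hconst := exists_eq_const_of_gradForm_self (hasC1Extension_of_mem_Vh ⟨c, d, hc, rfl⟩) h
  obtain rfl : d = 0 := bubbleCoeff_eq_zero hconst
  rw [bubblePart_zero, add_zero] at hconst
  exact ⟨conformingCoeff_eq_zero hc hconst, rfl⟩

theorem eq_of_representation_eq (hc : M.Admissible c) (hc' : M.Admissible c')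
    (h : M.conformingPart c + M.bubblePart d = M.conformingPart c' + M.bubblePart d') :
    c = c' ∧ d = d' := by
  have hzero : M.conformingPart (c - c') + M.bubblePart (d - d') = 0 := by
    rw [conformingPart_sub, bubblePart_sub, sub_add_sub_comm, h, sub_self]
  have henergy : M.gradForm (0 : R3 → R3) 0 = 0 := by
    simp [gradForm_eq_sum_gradDot, gradDot]
  rw [← hzero] at henergy
  exact (eq_zero_of_gradForm_self (hc.sub hc') henergy).imp sub_eq_zero.1 sub_eq_zero.1

variable (M) in
/-- The energy form `(∇u, ∇v)` as an inner product on the nonconforming velocity space. -/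
@[reducible]
def energyCore : InnerProductSpace.Core ℝ M.Vh where
  inner u v := M.gradForm u v
  conj_inner_symm u v := M.gradForm_comm v u
  re_inner_nonneg u := M.gradForm_self_nonneg u
  add_left u v w := gradForm_add_left (hasC1Extension_of_mem_Vh u.2)
    (hasC1Extension_of_mem_Vh v.2) (hasC1Extension_of_mem_Vh w.2)
  smul_left u v r := gradForm_smul_left (hasC1Extension_of_mem_Vh u.2) r v
  definite := by
    rintro ⟨u, c, d, hc, rfl⟩ h
    obtain ⟨rfl, rfl⟩ := eq_zero_of_gradForm_self hc h
    ext1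
    simp only [conformingPart_zero, bubblePart_zero, add_zero, ZeroMemClass.coe_zero]

end Coefficients

end TetMesh

end StokesP3

end

theorem lemma2p1 {n : ℕ} (M : StokesP3.TetMesh n) :
    (∃ I : InnerProductSpace.Core ℝ M.Vh, ∀ u v : M.Vh, I.inner u v = M.gradForm u v) ∧
    (∀ (c : M.nodes → Fin 3 → ℝ) (d : Fin n → Fin 9 → ℝ), M.Admissible c →
      ¬ (c = 0 ∧ d = 0) →
      0 < M.gradForm (M.conformingPart c + M.bubblePart d)
        (M.conformingPart c + M.bubblePart d)) ∧
    (∀ v ∈ M.Vh, ∃! cd : (M.nodes → Fin 3 → ℝ) × (Fin n → Fin 9 → ℝ),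
      M.Admissible cd.1 ∧ v = M.conformingPart cd.1 + M.bubblePart cd.2) := by
  refine ⟨⟨M.energyCore, fun _ _ => rfl⟩, fun c d hc hne => ?_, ?_⟩
  · exact (M.gradForm_self_nonneg _).lt_of_ne' fun h =>
      hne (StokesP3.TetMesh.eq_zero_of_gradForm_self hc h)
  · rintro _ ⟨c, d, hc, rfl⟩
    refine ⟨(c, d), ⟨hc, rfl⟩, ?_⟩
    rintro ⟨c', d'⟩ ⟨hc', h⟩
    obtain ⟨rfl, rfl⟩ := StokesP3.TetMesh.eq_of_representation_eq hc hc' h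
    rfl
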